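/- Consider a finite forest $H$ with a proper edge coloring, and let $s \ge 1$ be an integer. Call $H$ an $s$-pattern if its edge set is the union of $s$ matchings $M^1, \dots, M^s$, each of them monochromatic and different ones having different colors, such that for every $1 \le i \le s$ every edge of $M^i$ has an endpoint that is not covered by any edge of any $M^j$ with $i < j \le s$. A properly edge-colored graph $G$ contains a copy of $H$ if there is an isomorphism of $H$ onto a (not necessarily induced) subgraph of $G$ under which two edges of $H$ have the same color if and only if their images have the same color. Theorem. For all real $\delta, c > 0$, every integer $s \ge 1$ and every $s$-pattern $H$ there is an $n_0 = n_0(\delta, c, s, H)$ with the following property. Let $G$ be a graph on $n \ge n_0$ vertices with at least $\delta n^2$ edges, and let $G$ be properly edge-colored with at most $cn$ colors. Then $G$ contains a copy of $H$. -/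

import Mathlib

/-- A proper edge coloring of `G` with colors in `K`: distinct edges that share a vertex get
distinct colors. -/
abbrev ProperEdgeColoring {V : Type*} (G : SimpleGraph V) (K : Type*) : Type _ :=
  G.lineGraph.Coloring K

/-- A properly edge-colored graph `(H, C)` is an `s`-pattern if it is a forest and its edge set is
the union of `s` matchings `M 0, …, M (s - 1)`, each of them monochromatic and different ones having
different colors, such that every edge of `M i` has an endpoint that is not covered by any edge of
any later `M j`. (That each `M i` is a matching follows from its being monochromatic, since `C` is
proper.) -/
def IsSPattern {W L : Type*} {H : SimpleGraph W} (s : ℕ) (C : ProperEdgeColoring H L) : Prop :=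
  H.IsAcyclic ∧
    ∃ M : Fin s → Set H.edgeSet,
      (⋃ i, M i) = Set.univ ∧
      (∀ i j, ∀ e ∈ M i, ∀ f ∈ M j, C e = C f ↔ i = j) ∧
      (∀ i, ∀ e ∈ M i, ∃ v ∈ (e : Sym2 W), ∀ j, i < j → ∀ f ∈ M j, v ∉ (f : Sym2 W))

/-- The edge-colored graph `(G, D)` contains a copy of the edge-colored graph `(H, C)`: there is an
isomorphism of `H` onto a (not necessarily induced) subgraph of `G` under which two edges have the
same color if and only if their images have the same color. -/
def ContainsColoredCopy {V K W L : Type*} {G : SimpleGraph V} {H : SimpleGraph W}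
    (D : ProperEdgeColoring G K) (C : ProperEdgeColoring H L) : Prop :=
  ∃ φ : H.Copy G, ∀ e f : H.edgeSet, D (φ.mapEdgeSet e) = D (φ.mapEdgeSet f) ↔ C e = C f

/-!
The proof is by induction on the number `s` of matchings of the pattern. The edges of the first
matching are pendant: each of them has an endpoint that no later matching covers. Hence it is enough
to find a color `k` and a set `A'` of vertices such that `A'` spans a quadratic number of edges, and
every vertex of `A'` is joined by an edge of color `k` to a vertex outside `A'`. The later matchings
form a pattern with one matching fewer, which embeds into `A'` by induction, and the images of the
first matching are the `k`-edges at the images of its non-free endpoints. This is an injective map,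
because color classes are matchings and their second endpoints lie outside `A'`. Acyclicity of the
pattern plays no role, since it is forced by this way of building it up.

The color `k` comes from the triangle removal lemma (`many_shared_colors`). Let a tripartite
graph have two copies of the vertex set and the set of colors as its parts, with one triangle for each
edge `uv` of color `k`. Properness says that these triangles are edge-disjoint. There are quadratically
many of them and the graph has linearly many vertices, as the number of colors is linear. So it has
cubically many triangles, i.e. cubically many triples `(u, v, k)` where `uv` is an edge and each of
`u` and `v` is incident with an edge of color `k`. In `exists_dense_set_with_partners`, a
random set `R` is chosen; `A'` is the set of vertices in `R` whose `k`-partner is not in `R`.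
For a triple with `uv` not of color `k`, both `u` and `v` are in `A'` with probability at least `1/16`,
and averaging over `R` and `k` finishes the argument.
-/

/-! ### Proper edge colorings as relations -/

/-- `E k u v` says that `uv` is an edge of color `k`. The relation describes a properly edge-colored
simple graph: adjacency is symmetric and irreflexive, every color class is a matching, and every edge
has only one color. -/
structure IsProperColorRel {V K : Type*} (E : K → V → V → Prop) : Prop where
  symm : ∀ {k u v}, E k u v → E k v u
  irrefl : ∀ {k u}, ¬ E k u u
  matching : ∀ {k u v w}, E k u v → E k u w → v = w
  color_unique : ∀ {k l u v}, E k u v → E l u v → k = l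

open Classical in
/-- The ordered pairs of vertices in `A` that are joined by an edge. -/
noncomputable def adjPairs {V K : Type*} (E : K → V → V → Prop) (A : Finset V) : Finset (V × V) :=
  (A ×ˢ A).filter fun p => ∃ k, E k p.1 p.2

theorem mem_adjPairs {V K : Type*} {E : K → V → V → Prop} {A : Finset V} {p : V × V} :
    p ∈ adjPairs E A ↔ p.1 ∈ A ∧ p.2 ∈ A ∧ ∃ k, E k p.1 p.2 := by
  simp [adjPairs, and_assoc]

open Classical in
/-- The set of vertices `v ∈ A ∩ R` that have a neighbor in `A \ R` along color `k`. -/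
noncomputable def partneredSet {V K : Type*} (E : K → V → V → Prop) (A R : Finset V) (k : K) :
    Finset V :=
  A.filter fun v => v ∈ R ∧ ∃ w ∈ A, w ∉ R ∧ E k v w

open Classical in
/-- The triples `(u, v, k)` with `u`, `v` adjacent in `A` such that `u` and `v` are both incident with
an edge of color `k` inside `A`. -/
noncomputable def sharedTriples {V K : Type*} [Fintype K] (E : K → V → V → Prop) (A : Finset V) :
    Finset (V × V × K) :=
  (A ×ˢ A ×ˢ Finset.univ).filter fun p =>
    (∃ l, E l p.1 p.2.1) ∧ (∃ w ∈ A, E p.2.2 p.1 w) ∧ ∃ w ∈ A, E p.2.2 p.2.1 w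

/-! ### Shared colors via triangle removal -/

open SimpleGraph.TripartiteFromTriangles in
/-- The triangle removal lemma for the tripartite graph in which each edge `uv` of color `k` inside `A`
gives a triangle `u`, `v`, `k`. -/
theorem many_shared_colors (δ c : ℝ) (hδ : 0 < δ) (hc : 0 < c) :
    ∃ η : ℝ, 0 < η ∧ ∀ {V K : Type*} [Fintype V] [Fintype K] (E : K → V → V → Prop) (A : Finset V),
      IsProperColorRel E →
      (Fintype.card K : ℝ) ≤ c * Fintype.card V →
      δ * (Fintype.card V : ℝ) ^ 2 ≤ (adjPairs E A).card →
      η * (Fintype.card V : ℝ) ^ 3 ≤ (sharedTriples E A).card := by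
  classical
  refine ⟨SimpleGraph.triangleRemovalBound (δ / (2 + c) ^ 2),
    SimpleGraph.triangleRemovalBound_pos (by positivity), ?_⟩
  intro V K _ _ E A hE hK hA
  set n : ℝ := (Fintype.card V : ℝ) with hn
  have hn0 : 0 ≤ n := by positivity
  let t : Finset (V × V × K) := (A ×ˢ A ×ˢ Finset.univ).filter fun p => E p.2.2 p.1 p.2.1
  have ht : ∀ u v k, (u, v, k) ∈ t ↔ u ∈ A ∧ v ∈ A ∧ E k u v := by
    intro u v k; simp [t, and_assoc]
  have hdis : ExplicitDisjoint t := by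
    refine ⟨?_, ?_, ?_⟩
    · intro a b k a' h h'
      exact hE.matching (hE.symm ((ht ..).1 h).2.2) (hE.symm ((ht ..).1 h').2.2)
    · intro a b k b' h h'
      exact hE.matching ((ht ..).1 h).2.2 ((ht ..).1 h').2.2
    · intro a b k k' h h'
      exact hE.color_unique ((ht ..).1 h).2.2 ((ht ..).1 h').2.2
  have hcard : (adjPairs E A).card ≤ t.card := by
    refine (Finset.card_le_card ?_).trans (Finset.card_image_le (f := fun p => (p.1, p.2.1)))
    rintro ⟨u, v⟩ h
    simp only [adjPairs, Finset.mem_filter, Finset.mem_product] at h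
    obtain ⟨⟨hu, hv⟩, k, hk⟩ := h
    exact Finset.mem_image.2 ⟨(u, v, k), (ht ..).2 ⟨hu, hv, hk⟩, rfl⟩
  have hsum : (Fintype.card V + Fintype.card V + Fintype.card K : ℝ) ≤ (2 + c) * n := by
    linarith
  have hfar : (graph t).FarFromTriangleFree (δ / (2 + c) ^ 2) := by
    apply farFromTriangleFree
    push_cast
    calc δ / (2 + c) ^ 2 * (Fintype.card V + Fintype.card V + Fintype.card K : ℝ) ^ 2
        ≤ δ / (2 + c) ^ 2 * ((2 + c) * n) ^ 2 := by gcongr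
      _ = δ * n ^ 2 := by field_simp
      _ ≤ (adjPairs E A).card := hA
      _ ≤ t.card := by exact_mod_cast hcard
  have hle := hfar.le_card_cliqueFinset
  have hbd : 0 ≤ SimpleGraph.triangleRemovalBound (δ / (2 + c) ^ 2) :=
    (SimpleGraph.triangleRemovalBound_pos (by positivity)).le
  have hclique : ((graph t).cliqueFinset 3).card ≤ (sharedTriples E A).card := by
    refine (Finset.card_le_card ?_).trans (Finset.card_image_le (f := toTriangle))
    intro s hs
    rw [SimpleGraph.mem_cliqueFinset_iff, SimpleGraph.is3Clique_iff] at hs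
    obtain ⟨x, y, z, hxy, hxz, hyz, rfl⟩ := hs
    obtain ⟨a, b, k, habk, hab, hak, hbk⟩ := graph_triple hxy hxz hyz
    refine Finset.mem_image.2 ⟨(a, b, k), ?_, habk⟩
    obtain ⟨l, hl⟩ := Graph.in₀₁_iff.1 hab
    obtain ⟨b', hb'⟩ := Graph.in₀₂_iff.1 hak
    obtain ⟨a', ha'⟩ := Graph.in₁₂_iff.1 hbk
    rw [ht] at hl hb' ha'
    simp only [sharedTriples, Finset.mem_filter, Finset.mem_product, Finset.mem_univ, and_true]
    exact ⟨⟨hl.1, hl.2.1⟩, ⟨l, hl.2.2⟩, ⟨b', hb'.2.1, hb'.2.2⟩, a', ha'.1, hE.symm ha'.2.2⟩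
  calc SimpleGraph.triangleRemovalBound (δ / (2 + c) ^ 2) * n ^ 3
      ≤ SimpleGraph.triangleRemovalBound (δ / (2 + c) ^ 2) *
          (Fintype.card (V ⊕ V ⊕ K) : ℝ) ^ 3 := by
        gcongr
        simp only [Fintype.card_sum, hn]
        push_cast
        linarith [(Nat.cast_nonneg (Fintype.card V) : (0 : ℝ) ≤ _),
          (Nat.cast_nonneg (Fintype.card K) : (0 : ℝ) ≤ _)]
    _ ≤ (((graph t).cliqueFinset 3).card : ℝ) := hle
    _ ≤ ((sharedTriples E A).card : ℝ) := by exact_mod_cast hclique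

/-! ### Passing to a dense set of vertices with outside partners -/

/-- If neither of `u`, `v` is one of `u'`, `v'`, then a random set contains `u`, `v` and avoids `u'`,
`v'` with probability at least `1/16`. -/
theorem two_pow_card_le_card_filter_separating {V : Type*} [Fintype V] [DecidableEq V]
    {u v u' v' : V} (h1 : u ≠ u') (h2 : u ≠ v') (h3 : v ≠ u') (h4 : v ≠ v') :
    2 ^ Fintype.card V ≤ 16 * ((Finset.univ : Finset (Finset V)).filter
      fun R => u ∈ R ∧ v ∈ R ∧ u' ∉ R ∧ v' ∉ R).card := by
  have hsub : ({u, v} : Finset V) ⊆ {u', v'}ᶜ := by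
    intro x hx
    simp only [Finset.mem_insert, Finset.mem_singleton] at hx
    simp only [Finset.mem_compl, Finset.mem_insert, Finset.mem_singleton]
    rcases hx with rfl | rfl <;> simp [*]
  have heq : ((Finset.univ : Finset (Finset V)).filter
      fun R => u ∈ R ∧ v ∈ R ∧ u' ∉ R ∧ v' ∉ R) = Finset.Icc {u, v} {u', v'}ᶜ := by
    ext R
    simp only [Finset.mem_filter, Finset.mem_univ, true_and, Finset.mem_Icc,
      Finset.insert_subset_iff, Finset.singleton_subset_iff, Finset.subset_compl_comm (s := R),
      Finset.mem_compl, and_assoc]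
  rw [heq, Finset.card_Icc_finset hsub, Finset.card_compl]
  have a1 : ({u, v} : Finset V).card ≤ 2 := Finset.card_le_two
  have a2 : ({u', v'} : Finset V).card ≤ 2 := Finset.card_le_two
  rw [show 16 = 2 ^ 4 from rfl, ← pow_add]
  exact Nat.pow_le_pow_right (by norm_num) (by omega)

/-- Double counting of the pairs `(R, (u, v, k))` for which both `u` and `v` lie in
`partneredSet E A R k`. The triples with `uv` of color `k` itself have to be discarded, as the two
endpoints are then partners of each other; there are at most `n ^ 2` of them. -/
theorem sum_card_adjPairs_partneredSet {V K : Type*} [Fintype V] [Fintype K]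
    (E : K → V → V → Prop) (A : Finset V) (hE : IsProperColorRel E) :
    2 ^ Fintype.card V * (sharedTriples E A).card ≤
      16 * ∑ p : Finset V × K, (adjPairs E (partneredSet E A p.1 p.2)).card +
        2 ^ Fintype.card V * Fintype.card V ^ 2 := by
  classical
  let T := (sharedTriples E A).filter fun p => ¬ E p.2.2 p.1 p.2.1
  have hT : (sharedTriples E A).card ≤ T.card + Fintype.card V ^ 2 := by
    rw [← Finset.card_filter_add_card_filter_not (s := sharedTriples E A)
      (fun p => ¬ E p.2.2 p.1 p.2.1)]
    refine Nat.add_le_add_left ?_ _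
    rw [sq, ← Fintype.card_prod, ← Finset.card_univ]
    refine Finset.card_le_card_of_injOn (fun p => (p.1, p.2.1)) (fun _ _ => by simp) ?_
    rintro ⟨u, v, k⟩ h ⟨u', v', k'⟩ h' heq
    simp only [Finset.coe_filter, Set.mem_ofPred_eq, not_not] at h h'
    simp only [Prod.mk.injEq] at heq
    obtain ⟨rfl, rfl⟩ := heq
    rw [hE.color_unique h.2 h'.2]
  have hcount : 2 ^ Fintype.card V * T.card ≤
      16 * ∑ p : Finset V × K, (adjPairs E (partneredSet E A p.1 p.2)).card := by
    let good : V × V × K → Finset V → Prop := fun q R =>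
      (q.1, q.2.1) ∈ adjPairs E (partneredSet E A R q.2.2)
    have h1 : 2 ^ Fintype.card V * T.card ≤
        ∑ q ∈ T, 16 * ((Finset.univ : Finset (Finset V)).filter (good q)).card := by
      rw [mul_comm, ← smul_eq_mul]
      refine Finset.card_nsmul_le_sum _ _ _ ?_
      rintro ⟨u, v, k⟩ hq
      simp only [T, sharedTriples, Finset.mem_filter, Finset.mem_product, Finset.mem_univ,
        and_true] at hq
      obtain ⟨⟨⟨hu, hv⟩, hl, ⟨u', hu', huu'⟩, v', hv', hvv'⟩, hk⟩ := hq
      refine (two_pow_card_le_card_filter_separating (u := u) (v := v) (u' := u') (v' := v')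
        ?_ ?_ ?_ ?_).trans ?_
      · rintro rfl; exact hE.irrefl huu'
      · rintro rfl; exact hk (hE.symm hvv')
      · rintro rfl; exact hk huu'
      · rintro rfl; exact hE.irrefl hvv'
      · refine Nat.mul_le_mul_left _ (Finset.card_le_card ?_)
        intro R hR
        simp only [Finset.mem_filter, Finset.mem_univ, true_and] at hR
        simp only [good, adjPairs, partneredSet, Finset.mem_filter, Finset.mem_univ, true_and,
          Finset.mem_product]
        exact ⟨⟨⟨hu, hR.1, u', hu', hR.2.2.1, huu'⟩, hv, hR.2.1, v', hv', hR.2.2.2, hvv'⟩, hl⟩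
    refine h1.trans ?_
    rw [← Finset.mul_sum]
    refine Nat.mul_le_mul_left _ ?_
    rw [← Finset.card_sigma, ← Finset.card_sigma]
    refine Finset.card_le_card_of_injOn (fun x => ⟨(x.2, x.1.2.2), (x.1.1, x.1.2.1)⟩) ?_ ?_
    · rintro ⟨q, R⟩ h
      simp only [Finset.coe_sigma, Set.mem_sigma_iff, Finset.mem_coe, Finset.mem_filter] at h
      simpa using h.2.2
    · rintro ⟨⟨u, v, k⟩, R⟩ _ ⟨⟨u', v', k'⟩, R'⟩ _ h
      simp only [Sigma.mk.injEq, Prod.mk.injEq, heq_eq_eq] at h ⊢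
      tauto
  calc _ ≤ 2 ^ Fintype.card V * (T.card + Fintype.card V ^ 2) := Nat.mul_le_mul_left _ hT
    _ ≤ _ := by rw [mul_add]; exact Nat.add_le_add_right hcount _

theorem exists_dense_set_with_partners (δ c : ℝ) (hδ : 0 < δ) (hc : 0 < c) :
    ∃ δ' : ℝ, 0 < δ' ∧ ∃ n₀ : ℕ, ∀ {V K : Type*} [Fintype V] [Fintype K]
      (E : K → V → V → Prop) (A : Finset V), IsProperColorRel E →
      n₀ ≤ Fintype.card V →
      (Fintype.card K : ℝ) ≤ c * Fintype.card V →
      δ * (Fintype.card V : ℝ) ^ 2 ≤ (adjPairs E A).card →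
      ∃ (R : Finset V) (k : K),
        δ' * (Fintype.card V : ℝ) ^ 2 ≤ (adjPairs E (partneredSet E A R k)).card := by
  classical
  obtain ⟨η, hη, H⟩ := many_shared_colors δ c hδ hc
  refine ⟨η / (32 * c), by positivity, max 1 ⌈2 / η⌉₊, ?_⟩
  intro V K _ _ E A hE hn hK hA
  have hshared := H E A hE hK hA
  set n : ℝ := (Fintype.card V : ℝ) with hn_def
  have hn1 : 1 ≤ n := by
    rw [hn_def]; exact_mod_cast (le_max_left _ _).trans hn
  have hn2 : 2 ≤ η * n := by
    have : 2 / η ≤ n := (Nat.le_ceil _).trans (by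
      rw [hn_def]; exact_mod_cast (le_max_right _ _).trans hn)
    rwa [div_le_iff₀' hη] at this
  by_contra! hcon
  have hdc : (2 : ℝ) ^ Fintype.card V * (sharedTriples E A).card ≤
      16 * (∑ p : Finset V × K, (adjPairs E (partneredSet E A p.1 p.2)).card : ℝ) +
        2 ^ Fintype.card V * n ^ 2 := by
    rw [hn_def]
    exact_mod_cast sum_card_adjPairs_partneredSet E A hE
  -- Some color exists, so summing the strict inequalities keeps them strict.
  have hne : (Finset.univ : Finset (Finset V × K)).Nonempty := by
    rw [Finset.univ_nonempty_iff]
    have hpos : 0 < (adjPairs E A).card := by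
      have : (0 : ℝ) < (adjPairs E A).card := lt_of_lt_of_le (by positivity) hA
      exact_mod_cast this
    obtain ⟨p, hp⟩ := Finset.card_pos.1 hpos
    obtain ⟨-, -, k, -⟩ := mem_adjPairs.1 hp
    exact ⟨(∅, k)⟩
  have hsum : (∑ p : Finset V × K, (adjPairs E (partneredSet E A p.1 p.2)).card : ℝ) <
      2 ^ Fintype.card V * (c * n) * (η / (32 * c) * n ^ 2) := by
    calc _ < ∑ _p : Finset V × K, η / (32 * c) * n ^ 2 :=
          Finset.sum_lt_sum_of_nonempty hne fun p _ => hcon p.1 p.2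
      _ = 2 ^ Fintype.card V * Fintype.card K * (η / (32 * c) * n ^ 2) := by
          simp [Fintype.card_finset]
      _ ≤ _ := by gcongr
  have hP : (0 : ℝ) < 2 ^ Fintype.card V := by positivity
  have key : (2 : ℝ) ^ Fintype.card V * (η * n ^ 3) <
      2 ^ Fintype.card V * (η * n ^ 3 / 2 + n ^ 2) := by
    calc _ ≤ (2 : ℝ) ^ Fintype.card V * (sharedTriples E A).card := by gcongr
      _ ≤ _ := hdc
      _ < 16 * (2 ^ Fintype.card V * (c * n) * (η / (32 * c) * n ^ 2)) +
          2 ^ Fintype.card V * n ^ 2 := by gcongr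
      _ = _ := by field_simp; ring
  have key' := lt_of_mul_lt_mul_left key hP.le
  have : 2 * n ^ 2 ≤ (η * n) * n ^ 2 := by gcongr
  nlinarith

/-! ### Embedding patterns -/

/-- An `s`-pattern given by the adjacency relations `P 0, …, P (s - 1)` of its matchings: every edge of
`P i` has an endpoint that is not covered by any later `P j`. -/
structure IsPatternRel {W : Type*} {s : ℕ} (P : Fin s → W → W → Prop) : Prop where
  symm : ∀ {i x y}, P i x y → P i y x
  irrefl : ∀ {i x}, ¬ P i x x
  matching : ∀ {i x y z}, P i x y → P i x z → y = z
  free : ∀ {i x y}, P i x y → (∀ j, i < j → ∀ z, ¬ P j x z) ∨ (∀ j, i < j → ∀ z, ¬ P j y z)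

theorem IsPatternRel.tail {W : Type*} {s : ℕ} {P : Fin (s + 1) → W → W → Prop}
    (hP : IsPatternRel P) : IsPatternRel fun i : Fin s => P i.succ where
  symm := hP.symm
  irrefl := hP.irrefl
  matching := hP.matching
  free h := (hP.free h).imp (fun h _ hj => h _ (Fin.succ_lt_succ_iff.2 hj))
    (fun h _ hj => h _ (Fin.succ_lt_succ_iff.2 hj))

/-- In every edge of the first matching, one can select one endpoint that is not covered by the later
matchings. -/
theorem IsPatternRel.exists_free_endpoints {W : Type*} {s : ℕ} {P : Fin (s + 1) → W → W → Prop}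
    (hP : IsPatternRel P) : ∃ F : Set W,
      (∀ x ∈ F, (∃ y, P 0 x y ∧ y ∉ F) ∧ ∀ (j : Fin s) z, ¬ P j.succ x z) ∧
      ∀ x y, P 0 x y → x ∈ F ∨ y ∈ F := by
  classical
  let free : W → Prop := fun x => ∀ (j : Fin s) z, ¬ P j.succ x z
  -- If both endpoints are free, a well-order of `W` breaks the tie.
  refine ⟨{x | ∃ y, P 0 x y ∧ free x ∧ (free y → WellOrderingRel x y)}, ?_, ?_⟩
  · rintro x ⟨y, hxy, hx, h⟩
    refine ⟨⟨y, hxy, ?_⟩, hx⟩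
    rintro ⟨x', hyx, hy, h'⟩
    obtain rfl := hP.matching (hP.symm hxy) hyx
    exact asymm_of WellOrderingRel (h hy) (h' hx)
  · intro x y hxy
    have hfree : free x ∨ free y := (hP.free hxy).imp
      (fun h _ => h _ (Fin.succ_pos _)) (fun h _ => h _ (Fin.succ_pos _))
    have hne : x ≠ y := by rintro rfl; exact hP.irrefl hxy
    by_cases hx : free x
    · by_cases hy : free y
      · rcases trichotomous_of WellOrderingRel x y with h | h | h
        · exact Or.inl ⟨y, hxy, hx, fun _ => h⟩
        · exact absurd h hne
        · exact Or.inr ⟨x, hP.symm hxy, hy, fun _ => h⟩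
      · exact Or.inl ⟨y, hxy, hx, fun h => absurd h hy⟩
    · exact Or.inr ⟨x, hP.symm hxy, hfree.resolve_left hx, fun h => absurd h hx⟩

/-- `φ` embeds the pattern `P` into the vertex set `A`, with edges of `P i` going to edges of color
`κ i`; matchings without edges impose nothing on their color. -/
structure IsPatternEmbedding {V K W : Type*} {s : ℕ} (E : K → V → V → Prop) (A : Finset V)
    (P : Fin s → W → W → Prop) (φ : W → V) (κ : Fin s → K) : Prop where
  injective : Function.Injective φ
  mem : ∀ x, φ x ∈ A
  map_edge : ∀ {i x y}, P i x y → E (κ i) (φ x) (φ y)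
  color_injective : ∀ {i j x y x' y'}, P i x y → P j x' y' → κ i = κ j → i = j

/-- An embedding of the later matchings into a set of vertices with partners outside extends to the
first matching, by moving each selected free endpoint to the partner of the image of its neighbor. -/
theorem IsPatternEmbedding.extend {V K W : Type*} {s : ℕ} {E : K → V → V → Prop} {A R : Finset V}
    {k : K} {P : Fin (s + 1) → W → W → Prop} {φ : W → V} {κ : Fin s → K}
    (hE : IsProperColorRel E) (hP : IsPatternRel P)
    (h : IsPatternEmbedding E (partneredSet E A R k) (fun i : Fin s => P i.succ) φ κ) :
    ∃ ψ : W → V, IsPatternEmbedding E A P ψ (Fin.cons k κ : Fin (s + 1) → K) := by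
  classical
  have hmem : ∀ v, v ∈ partneredSet E A R k ↔ v ∈ A ∧ v ∈ R ∧ ∃ w ∈ A, w ∉ R ∧ E k v w := by
    intro v; simp [partneredSet]
  have hR : ∀ x, φ x ∈ R := fun x => ((hmem _).1 (h.mem x)).2.1
  obtain ⟨F, hF, hcover⟩ := hP.exists_free_endpoints
  have hτ : ∀ x, ∃ w ∈ A, w ∉ R ∧ E k (φ x) w := fun x => ((hmem _).1 (h.mem x)).2.2
  choose τ hτA hτR hτE using hτ
  choose y hy hyF using fun x (hx : x ∈ F) => (hF x hx).1
  let ψ : W → V := fun x => if hx : x ∈ F then τ (y x hx) else φ x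
  have ψ_in : ∀ x (hx : x ∈ F), ψ x = τ (y x hx) := fun x hx => dif_pos hx
  have ψ_out : ∀ x, x ∉ F → ψ x = φ x := fun x hx => dif_neg hx
  have later : ∀ {j : Fin s} {x z}, P j.succ x z → ψ x = φ x := fun {j x z} hxz =>
    ψ_out _ fun hx => (hF x hx).2 j z hxz
  have first : ∀ {x z}, P 0 x z → x ∈ F → E k (ψ x) (ψ z) := by
    intro x z hxz hx
    have hz : y x hx = z := hP.matching (hy x hx) hxz
    rw [ψ_in x hx, ← hz, ψ_out _ (hyF x hx)]
    exact hE.symm (hτE _)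
  -- Partners are outside `R`, so no edge of color `k` joins two vertices with partners.
  have hno : ∀ x z, ¬ E k (φ x) (φ z) := by
    intro x z hxz
    have := hE.matching hxz (hτE x)
    exact hτR x (this ▸ hR z)
  have hmap : ∀ i x z, P i x z → E ((Fin.cons k κ : Fin (s + 1) → K) i) (ψ x) (ψ z) := by
    intro i x z hxz
    induction i using Fin.cases with
    | zero =>
      rcases hcover x z hxz with hx | hz
      · exact first hxz hx
      · exact hE.symm (first (hP.symm hxz) hz)
    | succ j =>
      rw [later hxz, later (hP.symm hxz)]
      exact h.map_edge hxz
  refine ⟨ψ, ?_, ?_, fun {i x z} => hmap i x z, ?_⟩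
  · intro x x' hxx
    by_cases hx : x ∈ F <;> by_cases hx' : x' ∈ F
    · rw [ψ_in x hx, ψ_in x' hx'] at hxx
      have e1 := hE.symm (hτE (y x hx))
      have e2 := hE.symm (hτE (y x' hx'))
      rw [hxx] at e1
      have e3 := h.injective (hE.matching e1 e2)
      have e4 := hP.symm (hy x hx)
      rw [e3] at e4
      exact hP.matching e4 (hP.symm (hy x' hx'))
    · rw [ψ_in x hx, ψ_out x' hx'] at hxx
      exact absurd (hxx ▸ hR x') (hτR _)
    · rw [ψ_out x hx, ψ_in x' hx'] at hxx
      exact absurd (hxx ▸ hR x) (hτR _)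
    · rw [ψ_out x hx, ψ_out x' hx'] at hxx
      exact h.injective hxx
  · intro x
    by_cases hx : x ∈ F
    · rw [ψ_in x hx]; exact hτA _
    · rw [ψ_out x hx]; exact ((hmem _).1 (h.mem x)).1
  · intro i j x z x' z' hi hj hij
    induction i using Fin.cases with
    | zero =>
      induction j using Fin.cases with
      | zero => rfl
      | succ j =>
        have := h.map_edge hj
        simp only [Fin.cons_zero, Fin.cons_succ] at hij
        exact absurd (hij ▸ this) (hno _ _)
    | succ i =>
      induction j using Fin.cases with
      | zero =>
        have := h.map_edge hi
        simp only [Fin.cons_zero, Fin.cons_succ] at hij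
        exact absurd (hij ▸ this) (hno _ _)
      | succ j =>
        simp only [Fin.cons_succ] at hij
        rw [h.color_injective hi hj hij]

/-- Density is measured against the whole vertex set rather than against `A`. The bounds on the number
of vertices and colors then stay the same when the induction passes from `A` to a subset of it. -/
theorem exists_patternEmbedding {W : Type*} [Finite W] (c : ℝ) (hc : 0 < c) (s : ℕ)
    (P : Fin s → W → W → Prop) (hP : IsPatternRel P) (δ : ℝ) (hδ : 0 < δ) :
    ∃ n₀ : ℕ, ∀ {V K : Type*} [Fintype V] [Fintype K] (E : K → V → V → Prop) (A : Finset V),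
      IsProperColorRel E →
      n₀ ≤ Fintype.card V →
      (Fintype.card K : ℝ) ≤ c * Fintype.card V →
      δ * (Fintype.card V : ℝ) ^ 2 ≤ (adjPairs E A).card →
      ∃ (φ : W → V) (κ : Fin s → K), IsPatternEmbedding E A P φ κ := by
  classical
  induction s generalizing δ with
  | zero =>
    have := Fintype.ofFinite W
    obtain ⟨m, hm⟩ := exists_nat_ge ((Fintype.card W : ℝ) / δ)
    refine ⟨m, fun {V K} _ _ E A _ hn _ hA => ?_⟩
    -- `δ n² ≤ |A|² ≤ |A| n`, so `|A| ≥ δ n ≥ |W|`.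
    have hWA : Fintype.card W ≤ A.card := by
      have h1 : (Fintype.card W : ℝ) ≤ δ * Fintype.card V := by
        rw [← div_le_iff₀' hδ]
        exact hm.trans (by exact_mod_cast hn)
      have h2 : ((adjPairs E A).card : ℝ) ≤ A.card * A.card := by
        have : (adjPairs E A).card ≤ A.card * A.card := by
          rw [← Finset.card_product]
          refine Finset.card_le_card fun p hp => ?_
          obtain ⟨h, h', -⟩ := mem_adjPairs.1 hp
          exact Finset.mem_product.2 ⟨h, h'⟩
        exact_mod_cast this
      have h3 : (A.card : ℝ) ≤ Fintype.card V := by exact_mod_cast A.card_le_univ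
      rcases (Nat.cast_nonneg (Fintype.card V) : (0 : ℝ) ≤ _).eq_or_lt with h0 | h0
      · rw [← h0, mul_zero] at h1
        have : (Fintype.card W : ℝ) ≤ A.card := h1.trans (by positivity)
        exact_mod_cast this
      · have h4 : δ * Fintype.card V * Fintype.card V ≤ A.card * (Fintype.card V : ℝ) := by
          calc _ = δ * (Fintype.card V : ℝ) ^ 2 := by ring
            _ ≤ A.card * A.card := hA.trans h2
            _ ≤ _ := by gcongr
        have := h1.trans (le_of_mul_le_mul_right h4 h0)
        exact_mod_cast this
    rw [← Fintype.card_coe] at hWA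
    obtain ⟨f⟩ := Function.Embedding.nonempty_of_card_le hWA
    exact ⟨fun x => f x, Fin.elim0, Subtype.val_injective.comp f.injective, fun x => (f x).2,
      fun {i} => i.elim0, fun {i} => i.elim0⟩
  | succ s ih =>
    obtain ⟨δ', hδ', n₁, h₁⟩ := exists_dense_set_with_partners δ c hδ hc
    obtain ⟨n₂, h₂⟩ := ih _ hP.tail δ' hδ'
    refine ⟨max n₁ n₂, fun {V K} _ _ E A hE hn hK hA => ?_⟩
    obtain ⟨R, k, hRk⟩ := h₁ E A hE ((le_max_left _ _).trans hn) hK hA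
    obtain ⟨φ, κ, h⟩ := h₂ E _ hE ((le_max_right _ _).trans hn) hK hRk
    obtain ⟨ψ, hψ⟩ := h.extend hE hP
    exact ⟨ψ, _, hψ⟩

/-! ### Translation to graphs -/

/-- Edges of the same color that share a vertex have the same other endpoint. -/
theorem ProperEdgeColoring.matching {V K : Type*} {G : SimpleGraph V} (D : ProperEdgeColoring G K)
    {u v w : V} (hv : G.Adj u v) (hw : G.Adj u w) (h : D ⟨s(u, v), hv⟩ = D ⟨s(u, w), hw⟩) :
    v = w := by
  by_contra hne
  refine D.valid (v := ⟨s(u, v), hv⟩) (w := ⟨s(u, w), hw⟩) ?_ h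
  rw [SimpleGraph.lineGraph_adj_iff_exists]
  refine ⟨fun heq => hne ?_, u, by simp, by simp⟩
  exact Sym2.congr_right.1 (congrArg Subtype.val heq)

theorem ProperEdgeColoring.isProperColorRel {V K : Type*} {G : SimpleGraph V}
    (D : ProperEdgeColoring G K) :
    IsProperColorRel fun (k : Set.range D) u v => ∃ h : G.Adj u v, D ⟨s(u, v), h⟩ = k where
  symm := by
    rintro k u v ⟨h, hk⟩
    refine ⟨h.symm, ?_⟩
    rw [← hk]
    congr 2
    exact Sym2.eq_swap
  irrefl := by
    rintro k u ⟨h, -⟩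
    exact G.loopless.irrefl u h
  matching := by
    rintro k u v w ⟨hv, hk⟩ ⟨hw, hk'⟩
    exact D.matching hv hw (hk.trans hk'.symm)
  color_unique := by
    rintro k l u v ⟨h, hk⟩ ⟨h', hl⟩
    exact Subtype.ext (hk.symm.trans hl)

theorem ProperEdgeColoring.isPatternRel {W L : Type*} {H : SimpleGraph W}
    (C : ProperEdgeColoring H L) {s : ℕ} {M : Fin s → Set H.edgeSet}
    (hcol : ∀ i j, ∀ e ∈ M i, ∀ f ∈ M j, C e = C f ↔ i = j)
    (hfree : ∀ i, ∀ e ∈ M i, ∃ v ∈ (e : Sym2 W), ∀ j, i < j → ∀ f ∈ M j, v ∉ (f : Sym2 W)) :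
    IsPatternRel fun i x y => ∃ h : H.Adj x y, (⟨s(x, y), h⟩ : H.edgeSet) ∈ M i where
  symm := by
    rintro i x y ⟨h, hM⟩
    refine ⟨h.symm, ?_⟩
    rwa [show (⟨s(y, x), h.symm⟩ : H.edgeSet) = ⟨s(x, y), h⟩ from Subtype.ext Sym2.eq_swap]
  irrefl := by
    rintro i x ⟨h, -⟩
    exact H.loopless.irrefl x h
  matching := by
    rintro i x y z ⟨hy, hyM⟩ ⟨hz, hzM⟩
    exact C.matching hy hz ((hcol i i _ hyM _ hzM).2 rfl)
  free := by
    rintro i x y ⟨h, hM⟩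
    obtain ⟨v, hv, hv'⟩ := hfree i _ hM
    have key : ∀ j, i < j → ∀ z, ¬ ∃ h : H.Adj v z, (⟨s(v, z), h⟩ : H.edgeSet) ∈ M j := by
      rintro j hj z ⟨h, hM⟩
      exact hv' j hj _ hM (by simp)
    rcases Sym2.mem_iff.1 hv with rfl | rfl
    · exact Or.inl key
    · exact Or.inr key

theorem ncard_edgeSet_le_card_adjPairs {V K : Type*} [Fintype V] {G : SimpleGraph V}
    (D : ProperEdgeColoring G K) :
    G.edgeSet.ncard ≤ (adjPairs (fun (k : Set.range D) u v =>
      ∃ h : G.Adj u v, D ⟨s(u, v), h⟩ = k) Finset.univ).card := by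
  classical
  set T := adjPairs (fun (k : Set.range D) u v => ∃ h : G.Adj u v, D ⟨s(u, v), h⟩ = k) Finset.univ
    with hT
  have hsub : G.edgeSet ⊆ (T.image (fun p : V × V => s(p.1, p.2)) : Finset (Sym2 V)) := by
    intro e he
    induction e with
    | _ u v =>
      simp only [Finset.coe_image, Set.mem_image, Finset.mem_coe]
      refine ⟨(u, v), ?_, rfl⟩
      simp only [hT, adjPairs, Finset.mem_filter, Finset.mem_product, Finset.mem_univ, true_and]
      exact ⟨⟨D ⟨s(u, v), he⟩, ⟨_, rfl⟩⟩, he, rfl⟩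
  calc _ ≤ ((T.image (fun p : V × V => s(p.1, p.2)) : Finset (Sym2 V)) : Set (Sym2 V)).ncard :=
        Set.ncard_le_ncard hsub (Finset.finite_toSet _)
    _ ≤ T.card := by rw [Set.ncard_coe_finset]; exact Finset.card_image_le

theorem mainTheorem1 {W L : Type*} [Finite W] (δ c : ℝ) (hδ : 0 < δ) (hc : 0 < c)
    (s : ℕ) (hs : 1 ≤ s) (H : SimpleGraph W) (C : ProperEdgeColoring H L) (hC : IsSPattern s C) :
    ∃ n₀ : ℕ, ∀ {V K : Type*} [Finite V] (G : SimpleGraph V) (D : ProperEdgeColoring G K),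
      n₀ ≤ Nat.card V →
      δ * (Nat.card V : ℝ) ^ 2 ≤ (G.edgeSet.ncard : ℝ) →
      ((Set.range D).ncard : ℝ) ≤ c * (Nat.card V : ℝ) →
      ContainsColoredCopy D C := by
  classical
  obtain ⟨-, M, hM, hcol, hfree⟩ := hC
  obtain ⟨n₀, hn₀⟩ := exists_patternEmbedding c hc s _ (C.isPatternRel hcol hfree) δ hδ
  refine ⟨n₀, fun {V K} _ G D hn hG hD => ?_⟩
  have := Fintype.ofFinite V
  have hfin : (Set.range D).Finite := Set.finite_range D
  have := hfin.fintype
  rw [Nat.card_eq_fintype_card] at hn hG hD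
  obtain ⟨φ, κ, h⟩ := hn₀ _ Finset.univ D.isProperColorRel hn
    (by rwa [← Nat.card_eq_fintype_card, Nat.card_coe_set_eq])
    (hG.trans (by exact_mod_cast ncard_edgeSet_le_card_adjPairs D))
  have hidx : ∀ e : H.edgeSet, ∃ i, e ∈ M i := fun e => by
    have : e ∈ ⋃ i, M i := hM ▸ Set.mem_univ e
    simpa using this
  let ψ : H.Copy G := ⟨⟨φ, fun {x y} hxy => by
    obtain ⟨i, hi⟩ := hidx ⟨s(x, y), hxy⟩
    exact (h.map_edge ⟨hxy, hi⟩).1⟩, h.injective⟩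
  have hψ : ∀ (e : H.edgeSet) (i), e ∈ M i → D (ψ.mapEdgeSet e) = κ i := by
    rintro ⟨e, he⟩ i hi
    induction e with
    | _ x y => exact (h.map_edge ⟨he, hi⟩).2
  refine ⟨ψ, fun e f => ?_⟩
  obtain ⟨i, hi⟩ := hidx e
  obtain ⟨j, hj⟩ := hidx f
  rw [hψ e i hi, hψ f j hj, hcol i j e hi f hj]
  refine ⟨fun hij => ?_, fun hij => by rw [hij]⟩
  obtain ⟨e, he⟩ := e
  obtain ⟨f, hf⟩ := f
  induction e with
  | _ x y =>
    induction f with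
    | _ x' y' => exact h.color_injective ⟨he, hi⟩ ⟨hf, hj⟩ (Subtype.ext hij)
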